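/- Consider the Markovian jump linear system $x_{k+1}=A_{\theta_k}x_k+B_{\theta_k}u_k$, $y_k=C_{\theta_k}x_k$, with $x_k\in\mathbb{R}^n$, $u_k\in\mathbb{R}^m$, $y_k\in\mathbb{R}^q$, where $(\theta_k)_{k\ge 0}$ is a homogeneous Markov chain on $\Theta=\{1,\dots,N\}$ with transition probabilities $p_{ij}$. Let $I_k=(x_k,\theta_k)$, and let $Q_i\ge 0$ and $R_i>0$ ($i\in\Theta$) be symmetric weighting matrices. A control policy chooses $u_k$ as a function of $I_0,\dots,I_k$. Its cost is $$J(x_0,\theta_0)=\mathbb{E}\Big[\sum_{k=0}^\infty \big(x_k^TQ_{\theta_k}x_k+u_k^TR_{\theta_k}u_k\big)\,\Big|\,I_0\Big]\in[0,\infty],$$ and the optimal value function $J^*(x,i)$ is the infimum of the cost over all control policies, for $I_0=(x,i)$. A feedback $u_k=\mu(x_k,\theta_k)$ is called optimal if its cost equals $J^*(x,i)$ for every initial condition $(x,i)\in\mathbb{R}^n\times\Theta$. Assume: 1. (conditional independence) under every control policy and for every initial condition, $\mathbb{E}[f(x_{k+1})g(\theta_{k+1})\mid I_k]=\mathbb{E}[f(x_{k+1})\mid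 I_k]\,\mathbb{E}[g(\theta_{k+1})\mid I_k]$ almost surely, for all $k\ge0$ and all bounded measurable $f$ and $g$; 2. (ergodicity) for all $i,j\in\Theta$, the chain started at $i$ reaches $j$ within a finite number of steps with non-zero probability; 3. (mean-square stabilizability) there are $K_1,\dots,K_N\in\mathbb{R}^{m\times n}$ such that under $u_k=-K_{\theta_k}x_k$ one has $\sum_{k=0}^\infty\mathbb{E}[\|x_k\|^2\mid I_0]<\infty$ for every $I_0\in\mathbb{R}^n\times\Theta$. For $V:\mathbb{R}^n\times\Theta\to\mathbb{R}$ put $$\mathcal{Q}_V(x,i,u)=x^TQ_ix+u^TR_iu+\mathbb{E}\big[V(A_ix+B_iu,\theta_{k+1})\mid\theta_k=i\big].$$ Value iteration starts from $J^0=0$ and sets, for $j\ge 0$, $$u^j(x,i)\in\arg\min_{u}\mathcal{Q}_{J^j}(x,i,u),\qquad J^{j+1}(x,i)=\mathcal{Q}_{J^j}\big(x,i,u^j(x,i)\big).$$ Then sequences $(J^j)$, $(u^j)$ of this kind exist, and for all such sequences the following hold. * For every $(x,i)\in\mathbb{R}^n\times\Theta$, the sequence $(J^j(x,i))_{j\ge0}$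 is non-negative, non-decreasing and bounded; hence $J^\infty(x,i)=\lim_{j\to\infty}J^j(x,i)$ exists. * $J^\infty=J^*$; in particular $J^*$ is finite. * $J^\infty$ satisfies the HJB equation $J^\infty(x,i)=\min_u\mathcal{Q}_{J^\infty}(x,i,u)$ for all $(x,i)$, the minimum being attained. * An optimal feedback exists, and a feedback $\mu$ is optimal if and only if $\mu(x,i)\in\arg\min_u\mathcal{Q}_{J^\infty}(x,i,u)$ for all $(x,i)$. * For every optimal feedback $u^*$, $J^\infty$ satisfies the Bellman equation: $J^\infty(x,i)=\mathcal{Q}_{J^\infty}(x,i,u^*(x,i))$ for all $(x,i)$, and along the closed-loop trajectory with $u_k=u^*(x_k,\theta_k)$ from any initial condition, for all $k\ge0$, almost surely $$J^\infty(x_k,\theta_k)=x_k^TQ_{\theta_k}x_k+u_k^TR_{\theta_k}u_k+\mathbb{E}[J^\infty(x_{k+1},\theta_{k+1})\mid I_k].$$ -/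

import Mathlib

open MeasureTheory

noncomputable section

/-- The data of a discrete-time Markovian jump linear system
`x (k+1) = A_{θ k} x k + B_{θ k} u k`, `y k = C_{θ k} x k`, with `N` modes, mode transition
probabilities `trans i j`, and the weights `Q i ≥ 0`, `R i > 0` of the quadratic cost. -/
structure MJLS (n m q N : ℕ) where
  A : Fin N → Matrix (Fin n) (Fin n) ℝ
  B : Fin N → Matrix (Fin n) (Fin m) ℝ
  C : Fin N → Matrix (Fin q) (Fin n) ℝ
  trans : Matrix (Fin N) (Fin N) ℝ
  trans_nonneg : ∀ i j, 0 ≤ trans i j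
  trans_sum : ∀ i, ∑ j, trans i j = 1
  Q : Fin N → Matrix (Fin n) (Fin n) ℝ
  R : Fin N → Matrix (Fin m) (Fin m) ℝ
  Q_posSemidef : ∀ i, (Q i).PosSemidef
  R_posDef : ∀ i, (R i).PosDef

/-- `θ` is, under each `ℙ i`, a homogeneous Markov chain started at the mode `i` with transition
matrix `p`. So `ℙ i` is the conditional law given `θ 0 = i`. The Markov property
`P[θ (k+1) = s (k+1) | θ 0 = s 0, …, θ k = s k] = p (s k) (s (k+1))` is written without
division. -/
structure IsModeChain {N : ℕ} (p : Matrix (Fin N) (Fin N) ℝ) {Ω : Type*} [MeasurableSpace Ω]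
    (ℙ : Fin N → Measure Ω) (θ : ℕ → Ω → Fin N) : Prop where
  prob : ∀ i, IsProbabilityMeasure (ℙ i)
  meas : ∀ k, Measurable (θ k)
  init : ∀ i, ∀ᵐ ω ∂(ℙ i), θ 0 ω = i
  markov : ∀ (i : Fin N) (k : ℕ) (s : ℕ → Fin N),
    ℙ i {ω | ∀ l ≤ k + 1, θ l ω = s l} =
      ℙ i {ω | ∀ l ≤ k, θ l ω = s l} * ENNReal.ofReal (p (s k) (s (k + 1)))

/-- A causal control policy: the input at time `k` is a function of the information
`(x 0, θ 0), …, (x k, θ k)`. As the initial state is fixed and there are finitely many modes, this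
information takes finitely many values, so no measurability has to be imposed. -/
abbrev ControlPolicy (n m N : ℕ) : Type :=
  (k : ℕ) → (Fin (k + 1) → (Fin n → ℝ) × Fin N) → (Fin m → ℝ)

/-- The policy of a stationary state-and-mode feedback `u k = μ (x k) (θ k)`. -/
def feedbackPolicy {n m N : ℕ} (μ : (Fin n → ℝ) → Fin N → (Fin m → ℝ)) : ControlPolicy n m N :=
  fun k h => μ (h (Fin.last k)).1 (h (Fin.last k)).2

namespace MJLS

variable {n m q N : ℕ} (S : MJLS n m q N)

/-- The information `(x 0, θ 0), …, (x k, θ k)` generated by the policy `π` from the initial state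
`x₀` along the mode path `s`. -/
def history (π : ControlPolicy n m N) (x₀ : Fin n → ℝ) (s : ℕ → Fin N) :
    (k : ℕ) → (Fin (k + 1) → (Fin n → ℝ) × Fin N)
  | 0 => fun _ => (x₀, s 0)
  | k + 1 =>
    let h := history π x₀ s k
    Fin.snoc (α := fun _ => (Fin n → ℝ) × Fin N) h
      ((S.A (s k)).mulVec (h (Fin.last k)).1 + (S.B (s k)).mulVec (π k h), s (k + 1))

/-- The state `x k`. -/
def state (π : ControlPolicy n m N) (x₀ : Fin n → ℝ) (s : ℕ → Fin N) (k : ℕ) : Fin n → ℝ :=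
  (S.history π x₀ s k (Fin.last k)).1

/-- The input `u k`. -/
def input (π : ControlPolicy n m N) (x₀ : Fin n → ℝ) (s : ℕ → Fin N) (k : ℕ) : Fin m → ℝ :=
  π k (S.history π x₀ s k)

theorem state_zero (π : ControlPolicy n m N) (x₀ : Fin n → ℝ) (s : ℕ → Fin N) :
    S.state π x₀ s 0 = x₀ := rfl

theorem state_succ (π : ControlPolicy n m N) (x₀ : Fin n → ℝ) (s : ℕ → Fin N) (k : ℕ) :
    S.state π x₀ s (k + 1) =
      (S.A (s k)).mulVec (S.state π x₀ s k) + (S.B (s k)).mulVec (S.input π x₀ s k) := by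
  simp [state, input, history]

theorem history_last (π : ControlPolicy n m N) (x₀ : Fin n → ℝ) (s : ℕ → Fin N) (k : ℕ) :
    S.history π x₀ s k (Fin.last k) = (S.state π x₀ s k, s k) := by
  cases k <;> simp [state, history]

theorem input_feedback (μ : (Fin n → ℝ) → Fin N → (Fin m → ℝ)) (x₀ : Fin n → ℝ)
    (s : ℕ → Fin N) (k : ℕ) :
    S.input (feedbackPolicy μ) x₀ s k = μ (S.state (feedbackPolicy μ) x₀ s k) (s k) := by
  simp [input, feedbackPolicy, history_last]

/-- The stage cost `xᵀ Q_i x + uᵀ R_i u`. -/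
def stageCost (x : Fin n → ℝ) (i : Fin N) (u : Fin m → ℝ) : ℝ :=
  x ⬝ᵥ (S.Q i).mulVec x + u ⬝ᵥ (S.R i).mulVec u

variable {Ω : Type*} [MeasurableSpace Ω] (ℙ : Fin N → Measure Ω) (θ : ℕ → Ω → Fin N)

/-- The overall state `I k = (x k, θ k)` as a random variable. -/
def overallState (π : ControlPolicy n m N) (x₀ : Fin n → ℝ) (k : ℕ) (ω : Ω) :
    (Fin n → ℝ) × Fin N :=
  (S.state π x₀ (fun l => θ l ω) k, θ k ω)

/-- The σ-algebra generated by `I k`. -/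
abbrev overallSigma (π : ControlPolicy n m N) (x₀ : Fin n → ℝ) (k : ℕ) : MeasurableSpace Ω :=
  MeasurableSpace.comap (S.overallState θ π x₀ k) inferInstance

/-- Conditional independence of `x (k+1)` and `θ (k+1)` given `I k`, under every control policy
and from every initial condition:
`E[f(x (k+1)) g(θ (k+1)) | I k] = E[f(x (k+1)) | I k] E[g(θ (k+1)) | I k]`. -/
def ConditionallyIndependent : Prop :=
  ∀ (π : ControlPolicy n m N) (x₀ : Fin n → ℝ) (i : Fin N) (k : ℕ)
    (f : (Fin n → ℝ) → ℝ) (g : Fin N → ℝ), Measurable f → (∃ c, ∀ x, |f x| ≤ c) →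
    (ℙ i)[fun ω => f (S.overallState θ π x₀ (k + 1) ω).1 *
        g (S.overallState θ π x₀ (k + 1) ω).2 | S.overallSigma θ π x₀ k]
      =ᵐ[ℙ i]
    fun ω =>
      ((ℙ i)[fun ω' => f (S.overallState θ π x₀ (k + 1) ω').1 | S.overallSigma θ π x₀ k]) ω *
      ((ℙ i)[fun ω' => g (S.overallState θ π x₀ (k + 1) ω').2 | S.overallSigma θ π x₀ k]) ω

/-- Mean-square stability of the system controlled by `π`: `∑ₖ E[‖x k‖² | I 0] < ∞` for every
initial condition, with the Euclidean norm. -/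
def MeanSquareStable (π : ControlPolicy n m N) : Prop :=
  ∀ (x₀ : Fin n → ℝ) (i : Fin N),
    ∑' k, ∫⁻ ω, ENNReal.ofReal (‖WithLp.toLp 2 (S.overallState θ π x₀ k ω).1‖ ^ 2) ∂(ℙ i) < ⊤

/-- Mean-square stabilizability by a mode-dependent linear feedback `u k = - K_{θ k} x k`. -/
def MeanSquareStabilizable : Prop :=
  ∃ K : Fin N → Matrix (Fin m) (Fin n) ℝ,
    S.MeanSquareStable ℙ θ (feedbackPolicy fun x i => -(K i).mulVec x)

/-- The infinite-horizon cost of the policy `π` given `I 0 = (x₀, i)`. -/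
def cost (π : ControlPolicy n m N) (x₀ : Fin n → ℝ) (i : Fin N) : ENNReal :=
  ∫⁻ ω, ∑' k, ENNReal.ofReal (S.stageCost (S.state π x₀ (fun l => θ l ω) k) (θ k ω)
    (S.input π x₀ (fun l => θ l ω) k)) ∂(ℙ i)

/-- The optimal value function `J*`: the infimum of the cost over all causal control policies. -/
def optimalValue (x₀ : Fin n → ℝ) (i : Fin N) : ENNReal :=
  ⨅ π : ControlPolicy n m N, S.cost ℙ θ π x₀ i

/-- `μ` is an optimal feedback: it attains the optimal value from every initial condition. -/
def IsOptimalFeedback (μ : (Fin n → ℝ) → Fin N → (Fin m → ℝ)) : Prop :=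
  ∀ x i, S.cost ℙ θ (feedbackPolicy μ) x i = S.optimalValue ℙ θ x i

/-- `xᵀ Q_i x + uᵀ R_i u + E[V(x⁺, θ⁺)]`, where `x⁺ = A_i x + B_i u` and `θ⁺` is the mode that
follows the mode `i`. By homogeneity of the chain the expectation is taken over the first step. -/
def qValue (V : (Fin n → ℝ) → Fin N → ℝ) (x : Fin n → ℝ) (i : Fin N) (u : Fin m → ℝ) : ℝ :=
  S.stageCost x i u + ∫ ω, V ((S.A i).mulVec x + (S.B i).mulVec u) (θ 1 ω) ∂(ℙ i)

/-- `μ x i ∈ argmin_u [xᵀ Q_i x + uᵀ R_i u + E[V(x⁺, θ⁺)]]` for all `x` and `i`. -/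
def IsGreedy (V : (Fin n → ℝ) → Fin N → ℝ) (μ : (Fin n → ℝ) → Fin N → (Fin m → ℝ)) : Prop :=
  ∀ x i u, S.qValue ℙ θ V x i (μ x i) ≤ S.qValue ℙ θ V x i u

/-- `J` and `u` are sequences of value functions and control laws generated by value iteration
from `J 0 = 0`. -/
structure IsValueIteration (J : ℕ → (Fin n → ℝ) → Fin N → ℝ)
    (u : ℕ → (Fin n → ℝ) → Fin N → (Fin m → ℝ)) : Prop where
  zero : ∀ x i, J 0 x i = 0
  greedy : ∀ j, S.IsGreedy ℙ θ (J j) (u j)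
  succ : ∀ j x i, J (j + 1) x i = S.qValue ℙ θ (J j) x i (u j x i)

/-- The HJB equation `V(x, i) = min_u [xᵀ Q_i x + uᵀ R_i u + E[V(x⁺, θ⁺)]]`; the minimum is
attained. -/
def SatisfiesHJB (V : (Fin n → ℝ) → Fin N → ℝ) : Prop :=
  ∀ x i, IsLeast (Set.range (S.qValue ℙ θ V x i)) (V x i)

/-- The Bellman equation for the feedback `μ`, for each value of the overall state and along each
closed-loop trajectory:
`V(x k, θ k) = (x k)ᵀ Q (x k) + (u k)ᵀ R (u k) + E[V(x (k+1), θ (k+1)) | I k]` almost surely,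
with `u k = μ (x k) (θ k)`. -/
def SatisfiesBellman (V : (Fin n → ℝ) → Fin N → ℝ)
    (μ : (Fin n → ℝ) → Fin N → (Fin m → ℝ)) : Prop :=
  (∀ x i, V x i = S.qValue ℙ θ V x i (μ x i)) ∧
  ∀ (x₀ : Fin n → ℝ) (i : Fin N) (k : ℕ),
    (fun ω => V (S.overallState θ (feedbackPolicy μ) x₀ k ω).1 (θ k ω)) =ᵐ[ℙ i]
    fun ω =>
      S.stageCost (S.overallState θ (feedbackPolicy μ) x₀ k ω).1 (θ k ω)
        (μ (S.overallState θ (feedbackPolicy μ) x₀ k ω).1 (θ k ω)) +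
      ((ℙ i)[fun ω' => V (S.overallState θ (feedbackPolicy μ) x₀ (k + 1) ω').1 (θ (k + 1) ω') |
        S.overallSigma θ (feedbackPolicy μ) x₀ k]) ω

end MJLS

/-- Ergodicity of the mode chain: from each mode `i`, each mode `j` is reached within a finite
number of steps with non-zero probability. -/
def ModeErgodic {N : ℕ} {Ω : Type*} [MeasurableSpace Ω] (ℙ : Fin N → Measure Ω)
    (θ : ℕ → Ω → Fin N) : Prop :=
  ∀ i j, ∃ k, 0 < ℙ i {ω | θ k ω = j}

end

/-!
The iterates `J j` remain nonnegative and convex in the state, hence continuous, and `R > 0` makes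
`qValue (J j) x i` coercive in the input, so each minimization is solvable. By the Markov property
the value at time `k + 1`, conditioned on the modes up to time `k`, is the expectation in `qValue`;
iterating, `J T` is a lower bound for the expected cost of the first `T` stages of every policy.
The sublevel sets of `qValue (J j) x i` are compact and decrease with `j`, so they have a common
point, which lets the limit pass through the minimum and gives the HJB equation. Finally, along a
feedback that attains this minimum the stage costs telescope, so its cost is at most the limit,
which every policy's cost dominates.
-/

open Filter Topology

section QuadraticForm

variable {ι : Type*} [Fintype ι] {M : Matrix ι ι ℝ}

theorem exists_dotProduct_mulVec_eq_norm_sq (hM : M.PosSemidef) :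
    ∃ L : (ι → ℝ) →ₗ[ℝ] EuclideanSpace ℝ ι, ∀ x, x ⬝ᵥ M.mulVec x = ‖L x‖ ^ 2 := by
  classical
  open scoped MatrixOrder in
  obtain ⟨F, rfl⟩ := CStarAlgebra.nonneg_iff_eq_star_mul_self.mp hM.nonneg
  refine ⟨(WithLp.linearEquiv 2 ℝ (ι → ℝ)).symm.toLinearMap ∘ₗ F.mulVecLin, fun x => ?_⟩
  have hfactor : x ⬝ᵥ (star F * F).mulVec x = F.mulVec x ⬝ᵥ F.mulVec x := by
    rw [← Matrix.mulVec_mulVec, Matrix.dotProduct_mulVec, Matrix.star_eq_conjTranspose,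
      Matrix.conjTranspose_eq_transpose_of_trivial, Matrix.vecMul_transpose]
  rw [hfactor, EuclideanSpace.real_norm_sq_eq]
  simp [dotProduct, sq]

theorem convexOn_dotProduct_mulVec (hM : M.PosSemidef) :
    ConvexOn ℝ Set.univ fun x => x ⬝ᵥ M.mulVec x := by
  obtain ⟨L, hL⟩ := exists_dotProduct_mulVec_eq_norm_sq hM
  simp only [hL]
  exact ((convexOn_norm convex_univ).pow (fun _ _ => norm_nonneg _) 2).comp_linearMap L

theorem tendsto_dotProduct_mulVec_cocompact_atTop (hM : M.PosDef) :
    Tendsto (fun x => x ⬝ᵥ M.mulVec x) (cocompact (ι → ℝ)) atTop := by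
  obtain ⟨L, hL⟩ := exists_dotProduct_mulVec_eq_norm_sq hM.posSemidef
  have hker : LinearMap.ker L = ⊥ := LinearMap.ker_eq_bot'.2 fun x hx => by
    by_contra hx0
    simpa [hL, hx] using hM.dotProduct_mulVec_pos hx0
  obtain ⟨_, -, hanti⟩ := L.exists_antilipschitzWith hker
  simp only [hL, ← Metric.cobounded_eq_cocompact]
  exact (tendsto_pow_atTop two_ne_zero).comp
    (tendsto_norm_cobounded_atTop.comp hanti.tendsto_cobounded)

theorem exists_dotProduct_mulVec_le_mul_norm_sq (hM : M.PosSemidef) :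
    ∃ c, 0 ≤ c ∧ ∀ x : ι → ℝ, x ⬝ᵥ M.mulVec x ≤ c * ‖WithLp.toLp 2 x‖ ^ 2 := by
  obtain ⟨L, hL⟩ := exists_dotProduct_mulVec_eq_norm_sq hM
  let Lcont := (L ∘ₗ (WithLp.linearEquiv 2 ℝ (ι → ℝ)).toLinearMap).toContinuousLinearMap
  refine ⟨‖Lcont‖ ^ 2, sq_nonneg _, fun x => ?_⟩
  rw [hL, ← mul_pow]
  gcongr
  exact Lcont.le_opNorm (WithLp.toLp 2 x)

end QuadraticForm

theorem convexOn_apply_of_forall_le {E F : Type*} [AddCommGroup E] [Module ℝ E] [AddCommGroup F]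
    [Module ℝ F] {f : E × F → ℝ} (hf : ConvexOn ℝ Set.univ f) {g : E → F}
    (hg : ∀ x v, f (x, g x) ≤ f (x, v)) : ConvexOn ℝ Set.univ fun x => f (x, g x) :=
  ⟨convex_univ, fun x _ y _ a b ha hb hab => (hg _ (a • g x + b • g y)).trans
    (hf.2 (Set.mem_univ (x, g x)) (Set.mem_univ (y, g y)) ha hb hab)⟩

theorem convexOn_finset_sum {E κ : Type*} [AddCommGroup E] [Module ℝ E] {C : Set E}
    (hC : Convex ℝ C) (s : Finset κ) {f : κ → E → ℝ} (hf : ∀ j ∈ s, ConvexOn ℝ C (f j)) :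
    ConvexOn ℝ C fun x => ∑ j ∈ s, f j x := by
  simpa only [Finset.sum_fn] using
    Finset.sum_induction f (ConvexOn ℝ C) (fun _ _ => .add) (convexOn_const 0 hC) hf

theorem exists_forall_le_of_monotone_of_tendsto_cocompact {X γ : Type*} [TopologicalSpace X]
    [LinearOrder γ] [NoMaxOrder γ] {f : ℕ → X → γ} {c : γ} (hmono : Monotone f)
    (hsc : ∀ j, LowerSemicontinuous (f j)) (hcoercive : Tendsto (f 0) (cocompact X) atTop)
    (hle : ∀ j, ∃ x, f j x ≤ c) : ∃ x, ∀ j, f j x ≤ c := by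
  have hclosed (j : ℕ) : IsClosed (f j ⁻¹' Set.Iic c) := (hsc j).isClosed_preimage c
  obtain ⟨K, hK, hKc⟩ := mem_cocompact.1 (hcoercive.eventually_gt_atTop c)
  have hcompact : IsCompact (f 0 ⁻¹' Set.Iic c) :=
    hK.of_isClosed_subset (hclosed 0) fun x hx => by_contra fun hxK => (hKc hxK).not_ge hx
  obtain ⟨x, hx⟩ := IsCompact.nonempty_iInter_of_sequence_nonempty_isCompact_isClosed
    (fun j => f j ⁻¹' Set.Iic c) (fun j x => (hmono j.le_succ x).trans) hle hcompact hclosed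
  exact ⟨x, fun j => Set.mem_iInter.1 hx j⟩

section FiniteRange

variable {Ω : Type*}

theorem measurable_comap_comp_of_finite_range {γ β : Type*} [MeasurableSpace γ]
    [MeasurableSingletonClass γ] [MeasurableSpace β] {X : Ω → γ} (hX : (Set.range X).Finite)
    (F : γ → β) : Measurable[MeasurableSpace.comap X inferInstance] fun ω => F (X ω) := by
  refine fun T _ => ⟨F ⁻¹' T ∩ Set.range X, (hX.subset Set.inter_subset_right).measurableSet, ?_⟩
  ext ω
  simp

theorem integral_comp_eq_sum {γ : Type*} [Fintype γ] [MeasurableSpace γ]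
    [MeasurableSingletonClass γ] [MeasurableSpace Ω] {P : Measure Ω} [IsFiniteMeasure P]
    {X : Ω → γ} (hX : Measurable X) (F : γ → ℝ) :
    ∫ ω, F (X ω) ∂P = ∑ a, P.real (X ⁻¹' {a}) * F a := by
  rw [← integral_map hX.aemeasurable (measurable_of_finite F).aestronglyMeasurable,
    integral_fintype .of_finite]
  simp only [map_measureReal_apply hX (measurableSet_singleton _), smul_eq_mul]

end FiniteRange

theorem ae_eq_add_condExp_of_le {Ω E : Type*} [NormedAddCommGroup E] [NormedSpace ℝ E]
    [CompleteSpace E] {m₁ m₂ m₀ : MeasurableSpace Ω} {P : Measure Ω} [IsFiniteMeasure P]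
    {f g h : Ω → E} (hm₁ : m₁ ≤ m₂) (hm₂ : m₂ ≤ m₀) (hf : StronglyMeasurable[m₁] f)
    (hg : StronglyMeasurable[m₁] g) (hf_int : Integrable f P) (hg_int : Integrable g P)
    (hfgh : f =ᵐ[P] g + P[h | m₂]) : f =ᵐ[P] g + P[h | m₁] :=
  calc f = P[f | m₁] := (condExp_of_stronglyMeasurable (hm₁.trans hm₂) hf hf_int).symm
    _ =ᵐ[P] P[g + P[h | m₂] | m₁] := condExp_congr_ae hfgh
    _ =ᵐ[P] P[g | m₁] + P[P[h | m₂] | m₁] := condExp_add hg_int integrable_condExp m₁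
    _ =ᵐ[P] g + P[h | m₁] :=
      (condExp_of_stronglyMeasurable (hm₁.trans hm₂) hg hg_int).eventuallyEq.add
        (condExp_condExp_of_le hm₁ hm₂)

section ModePath

variable {Ω α : Type*}

/-- The modes `θ 0, …, θ k` as one random variable. -/
def modesUpTo (θ : ℕ → Ω → α) (k : ℕ) (ω : Ω) : Set.Iic k → α :=
  (Set.Iic k).domRestrict fun l => θ l ω

/-- The σ-algebra generated by the modes `θ 0, …, θ k`. -/
abbrev modesSigma [MeasurableSpace α] (θ : ℕ → Ω → α) (k : ℕ) : MeasurableSpace Ω :=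
  MeasurableSpace.comap (modesUpTo θ k) inferInstance

theorem measurable_modesUpTo [MeasurableSpace Ω] [MeasurableSpace α] {θ : ℕ → Ω → α}
    (hθ : ∀ k, Measurable (θ k)) (k : ℕ) : Measurable (modesUpTo θ k) :=
  measurable_pi_lambda _ fun l => hθ l

end ModePath

namespace IsModeChain

variable {N : ℕ} {p : Matrix (Fin N) (Fin N) ℝ} {Ω : Type*} [MeasurableSpace Ω]
  {ℙ : Fin N → Measure Ω} {θ : ℕ → Ω → Fin N}

theorem modesSigma_le (h : IsModeChain p ℙ θ) (k : ℕ) :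
    modesSigma θ k ≤ ‹MeasurableSpace Ω› :=
  (measurable_modesUpTo h.meas k).comap_le

theorem integrable_comp_modesUpTo (h : IsModeChain p ℙ θ) (i : Fin N) (k : ℕ)
    (G : (Set.Iic k → Fin N) → ℝ) : Integrable (fun ω => G (modesUpTo θ k ω)) (ℙ i) := by
  have := h.prob i
  exact Integrable.of_finite.comp_measurable (measurable_modesUpTo h.meas k)

theorem integral_of_init (h : IsModeChain p ℙ θ) (i : Fin N) (f : Fin N → ℝ) :
    ∫ ω, f (θ 0 ω) ∂(ℙ i) = f i := by
  have := h.prob i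
  rw [integral_congr_ae (g := fun _ => f i) ((h.init i).mono fun ω hω => congrArg f hω)]
  simp

theorem measureReal_modesUpTo_succ (h : IsModeChain p ℙ θ) (hp : ∀ i j, 0 ≤ p i j) (i : Fin N)
    (k : ℕ) (a : Set.Iic k → Fin N) (j : Fin N) :
    (ℙ i).real ((fun ω => (modesUpTo θ k ω, θ (k + 1) ω)) ⁻¹' {(a, j)}) =
      (ℙ i).real (modesUpTo θ k ⁻¹' {a}) * p (a ⟨k, Set.self_mem_Iic⟩) j := by
  let s (l : ℕ) : Fin N := if hl : l ∈ Set.Iic k then a ⟨l, hl⟩ else j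
  have hpast : modesUpTo θ k ⁻¹' {a} = {ω | ∀ l ≤ k, θ l ω = s l} := by
    ext ω
    simp +contextual [modesUpTo, funext_iff, s]
  have hfuture : (fun ω => (modesUpTo θ k ω, θ (k + 1) ω)) ⁻¹' {(a, j)} =
      {ω | ∀ l ≤ k + 1, θ l ω = s l} := by
    ext ω
    simp +contextual [modesUpTo, funext_iff, s, Nat.le_add_one_iff, or_imp, forall_and]
  have hsk : s k = a ⟨k, Set.self_mem_Iic⟩ := by simp [s]
  have hsj : s (k + 1) = j := by simp [s]
  rw [hfuture, hpast, Measure.real, h.markov i k s, ENNReal.toReal_mul,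
    ENNReal.toReal_ofReal (hp _ _), hsk, hsj, Measure.real]

theorem integral_modesUpTo_succ (h : IsModeChain p ℙ θ) (hp : ∀ i j, 0 ≤ p i j) (i : Fin N)
    (k : ℕ) (G : (Set.Iic k → Fin N) → Fin N → ℝ) :
    ∫ ω, G (modesUpTo θ k ω) (θ (k + 1) ω) ∂(ℙ i) =
      ∫ ω, ∑ j, p (θ k ω) j * G (modesUpTo θ k ω) j ∂(ℙ i) := by
  have := h.prob i
  have hpast := measurable_modesUpTo h.meas k
  calc ∫ ω, G (modesUpTo θ k ω) (θ (k + 1) ω) ∂(ℙ i)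
      = ∑ a, ∑ j, (ℙ i).real (modesUpTo θ k ⁻¹' {a}) * p (a ⟨k, Set.self_mem_Iic⟩) j * G a j := by
        rw [integral_comp_eq_sum (hpast.prodMk (h.meas (k + 1))) fun z => G z.1 z.2,
          Fintype.sum_prod_type]
        simp only [h.measureReal_modesUpTo_succ hp]
    _ = ∑ a, (ℙ i).real (modesUpTo θ k ⁻¹' {a}) * ∑ j, p (a ⟨k, Set.self_mem_Iic⟩) j * G a j := by
        simp only [Finset.mul_sum, mul_assoc]
    _ = ∫ ω, ∑ j, p (θ k ω) j * G (modesUpTo θ k ω) j ∂(ℙ i) :=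
        (integral_comp_eq_sum hpast fun a => ∑ j, p (a ⟨k, Set.self_mem_Iic⟩) j * G a j).symm

theorem integral_one (h : IsModeChain p ℙ θ) (hp : ∀ i j, 0 ≤ p i j) (i : Fin N)
    (f : Fin N → ℝ) : ∫ ω, f (θ 1 ω) ∂(ℙ i) = ∑ j, p i j * f j :=
  (h.integral_modesUpTo_succ hp i 0 fun _ => f).trans
    (h.integral_of_init i fun i => ∑ j, p i j * f j)

theorem condExp_modesUpTo_succ (h : IsModeChain p ℙ θ) (hp : ∀ i j, 0 ≤ p i j) (i : Fin N)
    (k : ℕ) (G : (Set.Iic k → Fin N) → Fin N → ℝ) :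
    (ℙ i)[fun ω => G (modesUpTo θ k ω) (θ (k + 1) ω) | modesSigma θ k] =ᵐ[ℙ i]
      fun ω => ∑ j, p (θ k ω) j * G (modesUpTo θ k ω) j := by
  have := h.prob i
  have hle := h.modesSigma_le k
  let H (a : Set.Iic k → Fin N) : ℝ := ∑ j, p (a ⟨k, Set.self_mem_Iic⟩) j * G a j
  have hnext : Integrable (fun ω => G (modesUpTo θ k ω) (θ (k + 1) ω)) (ℙ i) :=
    (Integrable.of_finite (f := fun z : (Set.Iic k → Fin N) × Fin N => G z.1 z.2)).comp_measurable
      ((measurable_modesUpTo h.meas k).prodMk (h.meas (k + 1)))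
  refine (ae_eq_condExp_of_forall_setIntegral_eq (g := fun ω => H (modesUpTo θ k ω)) hle hnext
    (fun _ _ _ => (h.integrable_comp_modesUpTo i k H).integrableOn) ?_
    ((measurable_of_finite H).comp (comap_measurable _)).aestronglyMeasurable).symm
  rintro _ ⟨T, hT, rfl⟩ -
  have hmeas : MeasurableSet (modesUpTo θ k ⁻¹' T) := hle _ ⟨T, hT, rfl⟩
  classical
  have hindicator := h.integral_modesUpTo_succ hp i k fun a j => if a ∈ T then G a j else 0
  simp only [mul_ite, mul_zero, Finset.sum_ite_irrel, Finset.sum_const_zero] at hindicator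
  rw [← integral_indicator hmeas, ← integral_indicator hmeas]
  exact hindicator.symm

end IsModeChain

namespace MJLS

variable {n m q N : ℕ}

section StageCost

variable (S : MJLS n m q N)

theorem input_cost_le_stageCost (x : Fin n → ℝ) (i : Fin N) (u : Fin m → ℝ) :
    u ⬝ᵥ (S.R i).mulVec u ≤ S.stageCost x i u :=
  le_add_of_nonneg_left (by simpa using (S.Q_posSemidef i).dotProduct_mulVec_nonneg x)

theorem stageCost_nonneg (x : Fin n → ℝ) (i : Fin N) (u : Fin m → ℝ) : 0 ≤ S.stageCost x i u :=
  le_trans (by simpa using (S.R_posDef i).posSemidef.dotProduct_mulVec_nonneg u)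
    (S.input_cost_le_stageCost x i u)

theorem convexOn_stageCost (i : Fin N) :
    ConvexOn ℝ Set.univ fun z : (Fin n → ℝ) × (Fin m → ℝ) => S.stageCost z.1 i z.2 :=
  ((convexOn_dotProduct_mulVec (S.Q_posSemidef i)).comp_linearMap (LinearMap.fst ℝ _ _)).add
    ((convexOn_dotProduct_mulVec (S.R_posDef i).posSemidef).comp_linearMap (LinearMap.snd ℝ _ _))

theorem tendsto_stageCost_cocompact_atTop (x : Fin n → ℝ) (i : Fin N) :
    Tendsto (S.stageCost x i) (cocompact (Fin m → ℝ)) atTop :=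
  tendsto_atTop_mono (S.input_cost_le_stageCost x i)
    (tendsto_dotProduct_mulVec_cocompact_atTop (S.R_posDef i))

theorem stageCost_neg_mulVec (K : Matrix (Fin m) (Fin n) ℝ) (x : Fin n → ℝ) (i : Fin N) :
    S.stageCost x i (-K.mulVec x) = x ⬝ᵥ (S.Q i + K.transpose * S.R i * K).mulVec x := by
  simp only [stageCost, Matrix.add_mulVec, dotProduct_add, Matrix.mulVec_neg, neg_dotProduct,
    dotProduct_neg, neg_neg, ← Matrix.mulVec_mulVec, Matrix.dotProduct_mulVec x K.transpose,
    Matrix.vecMul_transpose]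

theorem exists_stageCost_neg_mulVec_le (K : Fin N → Matrix (Fin m) (Fin n) ℝ) :
    ∃ c, 0 ≤ c ∧ ∀ x i, S.stageCost x i (-(K i).mulVec x) ≤ c * ‖WithLp.toLp 2 x‖ ^ 2 := by
  have hpos (i : Fin N) : (S.Q i + (K i).transpose * S.R i * K i).PosSemidef :=
    (S.Q_posSemidef i).add ((S.R_posDef i).posSemidef.conjTranspose_mul_mul_same (K i))
  choose c hc hle using fun i => exists_dotProduct_mulVec_le_mul_norm_sq (hpos i)
  refine ⟨∑ i, c i, Finset.sum_nonneg fun i _ => hc i, fun x i => ?_⟩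
  rw [stageCost_neg_mulVec]
  refine (hle i x).trans ?_
  gcongr
  exact Finset.single_le_sum (fun i _ => hc i) (Finset.mem_univ i)

end StageCost

section Trajectory

variable (S : MJLS n m q N) {Ω : Type*} (θ : ℕ → Ω → Fin N)

theorem history_dependsOn (π : ControlPolicy n m N) (x₀ : Fin n → ℝ) (k : ℕ) :
    DependsOn (fun s => S.history π x₀ s k) (Set.Iic k) := by
  induction k with
  | zero => exact fun s t hst => funext fun _ => congrArg (x₀, ·) (hst 0 Set.self_mem_Iic)
  | succ k ih =>
    intro s t hst
    have hpast : S.history π x₀ s k = S.history π x₀ t k :=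
      ih fun l hl => hst l (Nat.le_succ_of_le hl)
    simp only [history, hpast, hst k k.le_succ, hst (k + 1) Set.self_mem_Iic]

/-- The random variable `F (x k) (θ k) (u k)` along the trajectory that the policy `π` generates
from the initial state `x₀`. -/
def alongTrajectory {β : Type*} (π : ControlPolicy n m N) (x₀ : Fin n → ℝ) (k : ℕ)
    (F : (Fin n → ℝ) → Fin N → (Fin m → ℝ) → β) (ω : Ω) : β :=
  F (S.state π x₀ (fun l => θ l ω) k) (θ k ω) (S.input π x₀ (fun l => θ l ω) k)

theorem alongTrajectory_feedback {β : Type*} (μ : (Fin n → ℝ) → Fin N → (Fin m → ℝ))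
    (x₀ : Fin n → ℝ) (k : ℕ) (F : (Fin n → ℝ) → Fin N → (Fin m → ℝ) → β) :
    S.alongTrajectory θ (feedbackPolicy μ) x₀ k F =
      S.alongTrajectory θ (feedbackPolicy μ) x₀ k fun x j _ => F x j (μ x j) :=
  funext fun _ => congrArg (F _ _) (S.input_feedback μ x₀ _ k)

variable (π : ControlPolicy n m N) (x₀ : Fin n → ℝ) (k : ℕ)

theorem exists_alongTrajectory_eq_comp_modesUpTo {β : Type*}
    (F : (Fin n → ℝ) → Fin N → (Fin m → ℝ) → β) :
    ∃ G : (Set.Iic k → Fin N) → β,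
      ∀ ω, S.alongTrajectory θ π x₀ k F ω = G (modesUpTo θ k ω) := by
  refine ⟨fun a => F (S.state π x₀ (fun l => a ⟨min l k, min_le_right l k⟩) k)
    (a ⟨k, Set.self_mem_Iic⟩) (S.input π x₀ (fun l => a ⟨min l k, min_le_right l k⟩) k),
    fun ω => ?_⟩
  have hhist : S.history π x₀ (fun l => θ l ω) k = S.history π x₀ (fun l => θ (min l k) ω) k :=
    S.history_dependsOn π x₀ k fun l hl => by rw [min_eq_left (Set.mem_Iic.1 hl)]
  simp only [alongTrajectory, state, input, hhist, modesUpTo, Set.domRestrict_apply]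

theorem overallSigma_le_modesSigma : S.overallSigma θ π x₀ k ≤ modesSigma θ k := by
  obtain ⟨G, hG⟩ := S.exists_alongTrajectory_eq_comp_modesUpTo θ π x₀ k fun x i _ => (x, i)
  have hstate : S.overallState θ π x₀ k = G ∘ modesUpTo θ k := funext hG
  rw [overallSigma, hstate, ← MeasurableSpace.comap_comp]
  exact MeasurableSpace.comap_mono (measurable_of_finite G).comap_le

theorem stronglyMeasurable_alongTrajectory_overallSigma (f : (Fin n → ℝ) → Fin N → ℝ) :
    StronglyMeasurable[S.overallSigma θ π x₀ k]
      (S.alongTrajectory θ π x₀ k fun x i _ => f x i) := by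
  obtain ⟨G, hG⟩ := S.exists_alongTrajectory_eq_comp_modesUpTo θ π x₀ k fun x i _ => (x, i)
  have hfinite : (Set.range (S.overallState θ π x₀ k)).Finite :=
    (Set.finite_range G).subset (Set.range_subset_iff.2 fun ω => ⟨_, (hG ω).symm⟩)
  exact (measurable_comap_comp_of_finite_range hfinite fun z => f z.1 z.2).stronglyMeasurable

end Trajectory

variable {S : MJLS n m q N} {Ω : Type*} [MeasurableSpace Ω] {ℙ : Fin N → Measure Ω}
  {θ : ℕ → Ω → Fin N}

section QValue

variable {V : (Fin n → ℝ) → Fin N → ℝ} {μ : (Fin n → ℝ) → Fin N → (Fin m → ℝ)}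

theorem qValue_eq_sum (hchain : IsModeChain S.trans ℙ θ) (V : (Fin n → ℝ) → Fin N → ℝ)
    (x : Fin n → ℝ) (i : Fin N) (u : Fin m → ℝ) :
    S.qValue ℙ θ V x i u =
      S.stageCost x i u + ∑ j, S.trans i j * V ((S.A i).mulVec x + (S.B i).mulVec u) j := by
  rw [qValue, hchain.integral_one S.trans_nonneg]

theorem qValue_mono (hchain : IsModeChain S.trans ℙ θ) {W : (Fin n → ℝ) → Fin N → ℝ}
    (hVW : ∀ x i, V x i ≤ W x i) (x : Fin n → ℝ) (i : Fin N) (u : Fin m → ℝ) :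
    S.qValue ℙ θ V x i u ≤ S.qValue ℙ θ W x i u := by
  simp only [qValue_eq_sum hchain]
  gcongr with j
  · exact S.trans_nonneg i j
  · exact hVW _ _

theorem stageCost_le_qValue (hV : ∀ x i, 0 ≤ V x i) (x : Fin n → ℝ) (i : Fin N)
    (u : Fin m → ℝ) : S.stageCost x i u ≤ S.qValue ℙ θ V x i u :=
  le_add_of_nonneg_right (integral_nonneg fun _ => hV _ _)

theorem tendsto_qValue (hchain : IsModeChain S.trans ℙ θ) {J : ℕ → (Fin n → ℝ) → Fin N → ℝ}
    (hV : ∀ x i, Tendsto (fun j => J j x i) atTop (𝓝 (V x i))) (x : Fin n → ℝ) (i : Fin N)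
    (u : Fin m → ℝ) :
    Tendsto (fun j => S.qValue ℙ θ (J j) x i u) atTop (𝓝 (S.qValue ℙ θ V x i u)) := by
  simp only [qValue_eq_sum hchain]
  exact tendsto_const_nhds.add (tendsto_finsetSum _ fun j _ => (hV _ j).const_mul _)

theorem tendsto_qValue_cocompact_atTop (hV : ∀ x i, 0 ≤ V x i) (x : Fin n → ℝ) (i : Fin N) :
    Tendsto (S.qValue ℙ θ V x i) (cocompact (Fin m → ℝ)) atTop :=
  tendsto_atTop_mono (stageCost_le_qValue hV x i) (S.tendsto_stageCost_cocompact_atTop x i)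

theorem convexOn_qValue (hchain : IsModeChain S.trans ℙ θ)
    (hV : ∀ i, ConvexOn ℝ Set.univ fun x => V x i) (i : Fin N) :
    ConvexOn ℝ Set.univ
      fun z : (Fin n → ℝ) × (Fin m → ℝ) => S.qValue ℙ θ V z.1 i z.2 := by
  simp only [qValue_eq_sum hchain]
  refine (S.convexOn_stageCost i).add (convexOn_finset_sum convex_univ _ fun j _ => ?_)
  exact ((hV j).comp_linearMap
    ((S.A i).mulVecLin.coprod (S.B i).mulVecLin)).smul (S.trans_nonneg i j)

/-- Nonnegative value functions that are convex in the state: a class that value iteration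
preserves and on which minimizing inputs exist. -/
structure IsNonnegConvex (V : (Fin n → ℝ) → Fin N → ℝ) : Prop where
  nonneg : ∀ x i, 0 ≤ V x i
  convexOn : ∀ i, ConvexOn ℝ Set.univ fun x => V x i

namespace IsNonnegConvex

theorem zero : IsNonnegConvex (0 : (Fin n → ℝ) → Fin N → ℝ) :=
  ⟨fun _ _ => le_rfl, fun _ => convexOn_const 0 convex_univ⟩

theorem continuous_qValue (hV : IsNonnegConvex V) (hchain : IsModeChain S.trans ℙ θ)
    (x : Fin n → ℝ) (i : Fin N) : Continuous (S.qValue ℙ θ V x i) :=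
  (continuousOn_univ.1 ((convexOn_qValue hchain hV.convexOn i).continuousOn isOpen_univ)).comp
    (Continuous.prodMk_right x)

theorem exists_isGreedy (hV : IsNonnegConvex V) (hchain : IsModeChain S.trans ℙ θ) :
    ∃ μ, S.IsGreedy ℙ θ V μ := by
  choose μ hμ using fun x i => (hV.continuous_qValue hchain x i).exists_forall_le
    (tendsto_qValue_cocompact_atTop hV.nonneg x i)
  exact ⟨μ, hμ⟩

theorem qValue_of_isGreedy (hV : IsNonnegConvex V) (hchain : IsModeChain S.trans ℙ θ)
    (hμ : S.IsGreedy ℙ θ V μ) : IsNonnegConvex fun x i => S.qValue ℙ θ V x i (μ x i) where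
  nonneg x i := (S.stageCost_nonneg x i _).trans (stageCost_le_qValue hV.nonneg x i _)
  convexOn i := convexOn_apply_of_forall_le (convexOn_qValue hchain hV.convexOn i) (hμ · i)

end IsNonnegConvex

theorem SatisfiesHJB.isGreedy_iff (hHJB : S.SatisfiesHJB ℙ θ V) :
    S.IsGreedy ℙ θ V μ ↔ ∀ x i, V x i = S.qValue ℙ θ V x i (μ x i) := by
  refine forall₂_congr fun x i => ⟨fun hmin => ?_, fun heq v => heq ▸ (hHJB x i).2 ⟨v, rfl⟩⟩
  obtain ⟨v, hv⟩ := (hHJB x i).1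
  exact le_antisymm ((hHJB x i).2 ⟨_, rfl⟩) (hv ▸ hmin v)

theorem SatisfiesHJB.exists_isGreedy (hHJB : S.SatisfiesHJB ℙ θ V) :
    ∃ μ, S.IsGreedy ℙ θ V μ := by
  choose μ hμ using fun x i => (hHJB x i).1
  exact ⟨μ, hHJB.isGreedy_iff.2 fun x i => (hμ x i).symm⟩

end QValue

theorem exists_isValueIteration (hchain : IsModeChain S.trans ℙ θ) :
    ∃ J u, S.IsValueIteration ℙ θ J u := by
  choose! μ hμ using fun V (hV : IsNonnegConvex V) => hV.exists_isGreedy hchain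
  let step (V : (Fin n → ℝ) → Fin N → ℝ) : (Fin n → ℝ) → Fin N → ℝ :=
    fun x i => S.qValue ℙ θ V x i (μ V x i)
  have hstep (j : ℕ) : IsNonnegConvex (step^[j] 0) := by
    induction j with
    | zero => exact .zero
    | succ j ih =>
      rw [Function.iterate_succ_apply']
      exact ih.qValue_of_isGreedy hchain (hμ _ ih)
  exact ⟨fun j => step^[j] 0, fun j => μ (step^[j] 0),
    { zero := fun _ _ => rfl
      greedy := fun j => hμ _ (hstep j)
      succ := fun j x i => by rw [Function.iterate_succ_apply'] }⟩

namespace IsValueIteration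

variable {J : ℕ → (Fin n → ℝ) → Fin N → ℝ} {u : ℕ → (Fin n → ℝ) → Fin N → (Fin m → ℝ)}
  {V : (Fin n → ℝ) → Fin N → ℝ}

theorem isNonnegConvex (hJ : S.IsValueIteration ℙ θ J u) (hchain : IsModeChain S.trans ℙ θ)
    (j : ℕ) : IsNonnegConvex (J j) := by
  induction j with
  | zero =>
    rw [show J 0 = 0 from funext₂ hJ.zero]
    exact .zero
  | succ j ih =>
    rw [funext₂ (hJ.succ j)]
    exact ih.qValue_of_isGreedy hchain (hJ.greedy j)

theorem succ_le_qValue (hJ : S.IsValueIteration ℙ θ J u) (j : ℕ) (x : Fin n → ℝ) (i : Fin N)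
    (v : Fin m → ℝ) : J (j + 1) x i ≤ S.qValue ℙ θ (J j) x i v :=
  hJ.succ j x i ▸ hJ.greedy j x i v

theorem monotone (hJ : S.IsValueIteration ℙ θ J u) (hchain : IsModeChain S.trans ℙ θ) :
    Monotone J := by
  refine monotone_nat_of_le_succ fun j => ?_
  induction j with
  | zero => exact fun x i => (hJ.zero x i).trans_le ((hJ.isNonnegConvex hchain 1).nonneg x i)
  | succ j ih =>
    intro x i
    rw [hJ.succ (j + 1)]
    exact (hJ.succ_le_qValue j x i _).trans (qValue_mono hchain ih x i _)

theorem le_of_tendsto (hJ : S.IsValueIteration ℙ θ J u) (hchain : IsModeChain S.trans ℙ θ)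
    (hV : ∀ x i, Tendsto (fun j => J j x i) atTop (𝓝 (V x i))) (j : ℕ) (x : Fin n → ℝ)
    (i : Fin N) : J j x i ≤ V x i :=
  Monotone.ge_of_tendsto (fun _ _ hle => hJ.monotone hchain hle x i) (hV x i) j

theorem nonneg_of_tendsto (hJ : S.IsValueIteration ℙ θ J u) (hchain : IsModeChain S.trans ℙ θ)
    (hV : ∀ x i, Tendsto (fun j => J j x i) atTop (𝓝 (V x i))) (x : Fin n → ℝ) (i : Fin N) :
    0 ≤ V x i :=
  (hJ.zero x i).ge.trans (hJ.le_of_tendsto hchain hV 0 x i)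

theorem le_qValue_of_tendsto (hJ : S.IsValueIteration ℙ θ J u)
    (hchain : IsModeChain S.trans ℙ θ)
    (hV : ∀ x i, Tendsto (fun j => J j x i) atTop (𝓝 (V x i))) (x : Fin n → ℝ) (i : Fin N)
    (v : Fin m → ℝ) : V x i ≤ S.qValue ℙ θ V x i v :=
  le_of_tendsto_of_tendsto' ((hV x i).comp (tendsto_add_atTop_nat 1))
    (tendsto_qValue hchain hV x i v) fun j => hJ.succ_le_qValue j x i v

theorem exists_qValue_le_of_tendsto (hJ : S.IsValueIteration ℙ θ J u)
    (hchain : IsModeChain S.trans ℙ θ)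
    (hV : ∀ x i, Tendsto (fun j => J j x i) atTop (𝓝 (V x i))) (x : Fin n → ℝ) (i : Fin N) :
    ∃ v, S.qValue ℙ θ V x i v ≤ V x i := by
  have hJconvex := hJ.isNonnegConvex hchain
  obtain ⟨v, hv⟩ := exists_forall_le_of_monotone_of_tendsto_cocompact
    (f := fun j => S.qValue ℙ θ (J j) x i) (c := V x i)
    (fun _ _ hle => qValue_mono hchain (hJ.monotone hchain hle) x i)
    (fun j => ((hJconvex j).continuous_qValue hchain x i).lowerSemicontinuous)
    (tendsto_qValue_cocompact_atTop (hJconvex 0).nonneg x i)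
    (fun j => ⟨u j x i, hJ.succ j x i ▸ hJ.le_of_tendsto hchain hV (j + 1) x i⟩)
  exact ⟨v, le_of_tendsto' (tendsto_qValue hchain hV x i v) hv⟩

theorem satisfiesHJB_of_tendsto (hJ : S.IsValueIteration ℙ θ J u)
    (hchain : IsModeChain S.trans ℙ θ)
    (hV : ∀ x i, Tendsto (fun j => J j x i) atTop (𝓝 (V x i))) : S.SatisfiesHJB ℙ θ V := by
  intro x i
  obtain ⟨v, hv⟩ := hJ.exists_qValue_le_of_tendsto hchain hV x i
  exact ⟨⟨v, hv.antisymm (hJ.le_qValue_of_tendsto hchain hV x i v)⟩,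
    Set.forall_mem_range.2 (hJ.le_qValue_of_tendsto hchain hV x i)⟩

end IsValueIteration

section TrajectoryExpectation

variable (π : ControlPolicy n m N) (x₀ : Fin n → ℝ) (i : Fin N) (k : ℕ)

theorem integrable_alongTrajectory (hchain : IsModeChain S.trans ℙ θ)
    (F : (Fin n → ℝ) → Fin N → (Fin m → ℝ) → ℝ) :
    Integrable (S.alongTrajectory θ π x₀ k F) (ℙ i) := by
  obtain ⟨G, hG⟩ := S.exists_alongTrajectory_eq_comp_modesUpTo θ π x₀ k F
  exact funext hG ▸ hchain.integrable_comp_modesUpTo i k G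

theorem integral_alongTrajectory_zero (hchain : IsModeChain S.trans ℙ θ)
    (F : (Fin n → ℝ) → Fin N → (Fin m → ℝ) → ℝ) :
    ∫ ω, S.alongTrajectory θ π x₀ 0 F ω ∂(ℙ i) = F x₀ i (π 0 fun _ => (x₀, i)) :=
  hchain.integral_of_init i fun j => F x₀ j (π 0 fun _ => (x₀, j))

theorem alongTrajectory_qValue_ae_eq_add_condExp (hchain : IsModeChain S.trans ℙ θ)
    (V : (Fin n → ℝ) → Fin N → ℝ) :
    S.alongTrajectory θ π x₀ k (S.qValue ℙ θ V) =ᵐ[ℙ i]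
      S.alongTrajectory θ π x₀ k S.stageCost +
        (ℙ i)[S.alongTrajectory θ π x₀ (k + 1) fun x j _ => V x j | modesSigma θ k] := by
  obtain ⟨G, hG⟩ := S.exists_alongTrajectory_eq_comp_modesUpTo θ π x₀ k
    fun x i u => V ((S.A i).mulVec x + (S.B i).mulVec u)
  have hnext : (S.alongTrajectory θ π x₀ (k + 1) fun x j _ => V x j) =
      fun ω => G (modesUpTo θ k ω) (θ (k + 1) ω) := by
    funext ω
    simp only [← hG, alongTrajectory, state_succ]
  filter_upwards [hchain.condExp_modesUpTo_succ S.trans_nonneg i k G] with ω hω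
  rw [Pi.add_apply, hnext, hω]
  simp only [← hG, alongTrajectory, qValue_eq_sum hchain]

theorem integral_alongTrajectory_qValue (hchain : IsModeChain S.trans ℙ θ)
    (V : (Fin n → ℝ) → Fin N → ℝ) :
    ∫ ω, S.alongTrajectory θ π x₀ k (S.qValue ℙ θ V) ω ∂(ℙ i) =
      ∫ ω, S.alongTrajectory θ π x₀ k S.stageCost ω ∂(ℙ i) +
        ∫ ω, S.alongTrajectory θ π x₀ (k + 1) (fun x j _ => V x j) ω ∂(ℙ i) := by
  have := hchain.prob i
  rw [integral_congr_ae (alongTrajectory_qValue_ae_eq_add_condExp π x₀ i k hchain V),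
    integral_add' (integrable_alongTrajectory π x₀ i k hchain _) integrable_condExp,
    integral_condExp (hchain.modesSigma_le k)]

theorem integral_alongTrajectory_stageCost_nonneg :
    0 ≤ ∫ ω, S.alongTrajectory θ π x₀ k S.stageCost ω ∂(ℙ i) :=
  integral_nonneg fun _ => S.stageCost_nonneg _ _ _

end TrajectoryExpectation

theorem cost_eq_tsum (hchain : IsModeChain S.trans ℙ θ) (π : ControlPolicy n m N)
    (x : Fin n → ℝ) (i : Fin N) :
    S.cost ℙ θ π x i =
      ∑' k, ENNReal.ofReal (∫ ω, S.alongTrajectory θ π x k S.stageCost ω ∂(ℙ i)) := by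
  have hintegrable (k : ℕ) := integrable_alongTrajectory π x i k hchain S.stageCost
  simp only [fun k => ofReal_integral_eq_lintegral_ofReal (hintegrable k)
    (.of_forall fun _ => S.stageCost_nonneg _ _ _)]
  exact lintegral_tsum fun k => (hintegrable k).aemeasurable.ennreal_ofReal

theorem ofReal_sum_integral_stageCost_le_cost (hchain : IsModeChain S.trans ℙ θ)
    (π : ControlPolicy n m N) (x : Fin n → ℝ) (i : Fin N) (T : ℕ) :
    ENNReal.ofReal (∑ k ∈ Finset.range T, ∫ ω, S.alongTrajectory θ π x k S.stageCost ω ∂(ℙ i)) ≤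
      S.cost ℙ θ π x i := by
  rw [cost_eq_tsum hchain, ENNReal.ofReal_sum_of_nonneg fun k _ =>
    integral_alongTrajectory_stageCost_nonneg π x i k]
  exact ENNReal.sum_le_tsum _

theorem cost_le_ofReal_of_forall_sum_le (hchain : IsModeChain S.trans ℙ θ)
    {π : ControlPolicy n m N} {x : Fin n → ℝ} {i : Fin N} {c : ℝ}
    (hle : ∀ T, ∑ k ∈ Finset.range T,
      ∫ ω, S.alongTrajectory θ π x k S.stageCost ω ∂(ℙ i) ≤ c) :
    S.cost ℙ θ π x i ≤ ENNReal.ofReal c := by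
  rw [cost_eq_tsum hchain]
  refine ENNReal.tsum_le_of_sum_range_le fun T => ?_
  rw [← ENNReal.ofReal_sum_of_nonneg fun k _ =>
    integral_alongTrajectory_stageCost_nonneg π x i k]
  exact ENNReal.ofReal_le_ofReal (hle T)

theorem cost_feedback_le (hchain : IsModeChain S.trans ℙ θ) {V : (Fin n → ℝ) → Fin N → ℝ}
    {μ : (Fin n → ℝ) → Fin N → (Fin m → ℝ)} (hV : ∀ x i, 0 ≤ V x i)
    (hμ : ∀ x i, S.qValue ℙ θ V x i (μ x i) ≤ V x i) (x : Fin n → ℝ) (i : Fin N) :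
    S.cost ℙ θ (feedbackPolicy μ) x i ≤ ENNReal.ofReal (V x i) := by
  refine cost_le_ofReal_of_forall_sum_le hchain fun T => ?_
  let EV (k : ℕ) : ℝ :=
    ∫ ω, S.alongTrajectory θ (feedbackPolicy μ) x k (fun x j _ => V x j) ω ∂(ℙ i)
  have hstage (k : ℕ) :
      ∫ ω, S.alongTrajectory θ (feedbackPolicy μ) x k S.stageCost ω ∂(ℙ i) ≤ EV k - EV (k + 1) := by
    rw [le_sub_iff_add_le, ← integral_alongTrajectory_qValue _ x i k hchain V,
      alongTrajectory_feedback]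
    exact integral_mono (integrable_alongTrajectory _ x i k hchain _)
      (integrable_alongTrajectory _ x i k hchain _) fun _ => hμ _ _
  calc ∑ k ∈ Finset.range T, ∫ ω, S.alongTrajectory θ (feedbackPolicy μ) x k S.stageCost ω ∂(ℙ i)
      ≤ ∑ k ∈ Finset.range T, (EV k - EV (k + 1)) := Finset.sum_le_sum fun k _ => hstage k
    _ = EV 0 - EV T := Finset.sum_range_sub' EV T
    _ ≤ EV 0 := sub_le_self _ (integral_nonneg fun _ => hV _ _)
    _ = V x i := integral_alongTrajectory_zero _ x i hchain _

theorem optimalValue_lt_top (hchain : IsModeChain S.trans ℙ θ)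
    (hstab : S.MeanSquareStabilizable ℙ θ) (x : Fin n → ℝ) (i : Fin N) :
    S.optimalValue ℙ θ x i < ⊤ := by
  obtain ⟨K, hK⟩ := hstab
  obtain ⟨c, hc, hle⟩ := S.exists_stageCost_neg_mulVec_le K
  let π : ControlPolicy n m N := feedbackPolicy fun x i => -(K i).mulVec x
  calc S.optimalValue ℙ θ x i
      ≤ S.cost ℙ θ π x i := iInf_le _ π
    _ = ∑' k, ∫⁻ ω, ENNReal.ofReal (S.alongTrajectory θ π x k S.stageCost ω) ∂(ℙ i) :=
        lintegral_tsum fun k =>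
          (integrable_alongTrajectory π x i k hchain S.stageCost).aemeasurable.ennreal_ofReal
    _ ≤ ∑' k, ∫⁻ ω, ENNReal.ofReal c *
          ENNReal.ofReal (‖WithLp.toLp 2 (S.overallState θ π x k ω).1‖ ^ 2) ∂(ℙ i) := by
        gcongr with k ω
        rw [← ENNReal.ofReal_mul hc, alongTrajectory_feedback]
        exact ENNReal.ofReal_le_ofReal (hle _ _)
    _ = ENNReal.ofReal c *
          ∑' k, ∫⁻ ω, ENNReal.ofReal (‖WithLp.toLp 2 (S.overallState θ π x k ω).1‖ ^ 2) ∂(ℙ i) := by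
        simp only [lintegral_const_mul' _ _ ENNReal.ofReal_ne_top, ENNReal.tsum_mul_left]
    _ < ⊤ := ENNReal.mul_lt_top ENNReal.ofReal_lt_top (hK x i)

theorem satisfiesBellman_of_forall_eq (hchain : IsModeChain S.trans ℙ θ)
    {V : (Fin n → ℝ) → Fin N → ℝ} {μ : (Fin n → ℝ) → Fin N → (Fin m → ℝ)}
    (hμ : ∀ x i, V x i = S.qValue ℙ θ V x i (μ x i)) : S.SatisfiesBellman ℙ θ V μ := by
  refine ⟨hμ, fun x₀ i k => ?_⟩
  have := hchain.prob i
  let π := feedbackPolicy μ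
  have hgivenModes : (S.alongTrajectory θ π x₀ k fun x j _ => V x j) =ᵐ[ℙ i]
      (S.alongTrajectory θ π x₀ k fun x j _ => S.stageCost x j (μ x j)) +
        (ℙ i)[S.alongTrajectory θ π x₀ (k + 1) fun x j _ => V x j | modesSigma θ k] := by
    simpa only [π, alongTrajectory_feedback, ← hμ] using
      alongTrajectory_qValue_ae_eq_add_condExp π x₀ i k hchain V
  have hmeas := S.stronglyMeasurable_alongTrajectory_overallSigma θ π x₀ k
  have hintegrable := integrable_alongTrajectory π x₀ i k hchain
  have hgivenState := ae_eq_add_condExp_of_le (S.overallSigma_le_modesSigma θ π x₀ k)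
    (hchain.modesSigma_le k) (hmeas _) (hmeas _) (hintegrable _) (hintegrable _) hgivenModes
  exact hgivenState

namespace IsValueIteration

variable {J : ℕ → (Fin n → ℝ) → Fin N → ℝ} {u : ℕ → (Fin n → ℝ) → Fin N → (Fin m → ℝ)}
  {V : (Fin n → ℝ) → Fin N → ℝ}

theorem integral_alongTrajectory_qValue_le_sum (hJ : S.IsValueIteration ℙ θ J u)
    (hchain : IsModeChain S.trans ℙ θ) (π : ControlPolicy n m N) (x : Fin n → ℝ) (i : Fin N)
    (T s : ℕ) :
    ∫ ω, S.alongTrajectory θ π x s (S.qValue ℙ θ (J T)) ω ∂(ℙ i) ≤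
      ∑ k ∈ Finset.range (T + 1), ∫ ω, S.alongTrajectory θ π x (s + k) S.stageCost ω ∂(ℙ i) := by
  induction T generalizing s with
  | zero =>
    rw [integral_alongTrajectory_qValue π x i s hchain]
    simp [alongTrajectory, hJ.zero]
  | succ T ih =>
    have hstep : ∫ ω, S.alongTrajectory θ π x (s + 1) (fun x j _ => J (T + 1) x j) ω ∂(ℙ i) ≤
        ∫ ω, S.alongTrajectory θ π x (s + 1) (S.qValue ℙ θ (J T)) ω ∂(ℙ i) :=
      integral_mono (integrable_alongTrajectory π x i (s + 1) hchain _)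
        (integrable_alongTrajectory π x i (s + 1) hchain _) fun _ => hJ.succ_le_qValue T _ _ _
    rw [integral_alongTrajectory_qValue π x i s hchain, Finset.sum_range_succ',
      add_comm (Finset.sum _ _)]
    refine add_le_add le_rfl (hstep.trans ?_)
    simpa only [add_assoc, add_comm 1] using ih (s + 1)

theorem ofReal_qValue_le_cost (hJ : S.IsValueIteration ℙ θ J u)
    (hchain : IsModeChain S.trans ℙ θ) (π : ControlPolicy n m N) (x : Fin n → ℝ) (i : Fin N)
    (T : ℕ) :
    ENNReal.ofReal (S.qValue ℙ θ (J T) x i (π 0 fun _ => (x, i))) ≤ S.cost ℙ θ π x i := by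
  refine le_trans (ENNReal.ofReal_le_ofReal ?_)
    (ofReal_sum_integral_stageCost_le_cost hchain π x i (T + 1))
  simpa only [integral_alongTrajectory_zero π x i hchain, zero_add] using
    hJ.integral_alongTrajectory_qValue_le_sum hchain π x i T 0

theorem bddAbove_range (hJ : S.IsValueIteration ℙ θ J u) (hchain : IsModeChain S.trans ℙ θ)
    {x : Fin n → ℝ} {i : Fin N} (hfin : S.optimalValue ℙ θ x i < ⊤) :
    BddAbove (Set.range fun j => J j x i) := by
  obtain ⟨π, hπ⟩ := iInf_lt_iff.1 hfin
  refine ⟨(S.cost ℙ θ π x i).toReal, Set.forall_mem_range.2 fun j => ?_⟩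
  calc J j x i
      ≤ J (j + 1) x i := hJ.monotone hchain j.le_succ x i
    _ ≤ S.qValue ℙ θ (J j) x i (π 0 fun _ => (x, i)) := hJ.succ_le_qValue j x i _
    _ ≤ (S.cost ℙ θ π x i).toReal :=
      (ENNReal.ofReal_le_iff_le_toReal hπ.ne).1 (hJ.ofReal_qValue_le_cost hchain π x i j)

theorem ofReal_qValue_le_cost_of_tendsto (hJ : S.IsValueIteration ℙ θ J u)
    (hchain : IsModeChain S.trans ℙ θ)
    (hV : ∀ x i, Tendsto (fun j => J j x i) atTop (𝓝 (V x i))) (π : ControlPolicy n m N)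
    (x : Fin n → ℝ) (i : Fin N) :
    ENNReal.ofReal (S.qValue ℙ θ V x i (π 0 fun _ => (x, i))) ≤ S.cost ℙ θ π x i :=
  le_of_tendsto' (ENNReal.tendsto_ofReal (tendsto_qValue hchain hV x i _))
    (hJ.ofReal_qValue_le_cost hchain π x i)

theorem cost_feedback_le_of_isGreedy (hJ : S.IsValueIteration ℙ θ J u)
    (hchain : IsModeChain S.trans ℙ θ)
    (hV : ∀ x i, Tendsto (fun j => J j x i) atTop (𝓝 (V x i)))
    {μ : (Fin n → ℝ) → Fin N → (Fin m → ℝ)} (hμ : S.IsGreedy ℙ θ V μ) (x : Fin n → ℝ)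
    (i : Fin N) : S.cost ℙ θ (feedbackPolicy μ) x i ≤ ENNReal.ofReal (V x i) :=
  cost_feedback_le hchain (hJ.nonneg_of_tendsto hchain hV)
    (fun x i => ((hJ.satisfiesHJB_of_tendsto hchain hV).isGreedy_iff.1 hμ x i).ge) x i

theorem optimalValue_eq_of_tendsto (hJ : S.IsValueIteration ℙ θ J u)
    (hchain : IsModeChain S.trans ℙ θ)
    (hV : ∀ x i, Tendsto (fun j => J j x i) atTop (𝓝 (V x i))) (x : Fin n → ℝ) (i : Fin N) :
    S.optimalValue ℙ θ x i = ENNReal.ofReal (V x i) := by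
  obtain ⟨μ, hμ⟩ := (hJ.satisfiesHJB_of_tendsto hchain hV).exists_isGreedy
  refine le_antisymm ((iInf_le _ _).trans (hJ.cost_feedback_le_of_isGreedy hchain hV hμ x i))
    (le_iInf fun π => ?_)
  exact (ENNReal.ofReal_le_ofReal (hJ.le_qValue_of_tendsto hchain hV x i _)).trans
    (hJ.ofReal_qValue_le_cost_of_tendsto hchain hV π x i)

theorem isOptimalFeedback_iff_isGreedy (hJ : S.IsValueIteration ℙ θ J u)
    (hchain : IsModeChain S.trans ℙ θ)
    (hV : ∀ x i, Tendsto (fun j => J j x i) atTop (𝓝 (V x i)))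
    (μ : (Fin n → ℝ) → Fin N → (Fin m → ℝ)) :
    S.IsOptimalFeedback ℙ θ μ ↔ S.IsGreedy ℙ θ V μ := by
  have hopt := hJ.optimalValue_eq_of_tendsto hchain hV
  have hHJB := hJ.satisfiesHJB_of_tendsto hchain hV
  constructor
  · refine fun hμ => hHJB.isGreedy_iff.2 fun x i => ((hHJB x i).2 ⟨_, rfl⟩).antisymm ?_
    rw [← ENNReal.ofReal_le_ofReal_iff (hJ.nonneg_of_tendsto hchain hV x i), ← hopt, ← hμ x i]
    exact hJ.ofReal_qValue_le_cost_of_tendsto hchain hV (feedbackPolicy μ) x i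
  · exact fun hμ x i => le_antisymm
      (hopt x i ▸ hJ.cost_feedback_le_of_isGreedy hchain hV hμ x i) (iInf_le _ _)

end IsValueIteration

end MJLS

theorem theorem2_general {n m q N : ℕ} (S : MJLS n m q N)
    {Ω : Type*} [MeasurableSpace Ω] (ℙ : Fin N → Measure Ω) (θ : ℕ → Ω → Fin N)
    (hchain : IsModeChain S.trans ℙ θ)
    (hfin : ∀ x i, S.optimalValue ℙ θ x i < ⊤) :
    (∃ J u, S.IsValueIteration ℙ θ J u) ∧
    ∀ J u, S.IsValueIteration ℙ θ J u →
      (∀ x i, (∀ j, 0 ≤ J j x i) ∧ Monotone (fun j => J j x i) ∧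
        BddAbove (Set.range fun j => J j x i)) ∧
      ∃ Jinf : (Fin n → ℝ) → Fin N → ℝ,
        (∀ x i, Filter.Tendsto (fun j => J j x i) Filter.atTop (nhds (Jinf x i))) ∧
        (∀ x i, S.optimalValue ℙ θ x i = ENNReal.ofReal (Jinf x i)) ∧
        S.SatisfiesHJB ℙ θ Jinf ∧
        (∃ μ, S.IsOptimalFeedback ℙ θ μ) ∧
        ∀ μ, (S.IsOptimalFeedback ℙ θ μ ↔ S.IsGreedy ℙ θ Jinf μ) ∧
          (S.IsOptimalFeedback ℙ θ μ → S.SatisfiesBellman ℙ θ Jinf μ) := by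
  refine ⟨MJLS.exists_isValueIteration hchain, fun J u hJ => ?_⟩
  have hmono (x : Fin n → ℝ) (i : Fin N) : Monotone fun j => J j x i :=
    fun _ _ hle => hJ.monotone hchain hle x i
  have hbdd (x : Fin n → ℝ) (i : Fin N) : BddAbove (Set.range fun j => J j x i) :=
    hJ.bddAbove_range hchain (hfin x i)
  refine ⟨fun x i => ⟨fun j => (hJ.isNonnegConvex hchain j).nonneg x i, hmono x i, hbdd x i⟩,
    fun x i => ⨆ j, J j x i, ?_⟩
  have hlim (x : Fin n → ℝ) (i : Fin N) := tendsto_atTop_ciSup (hmono x i) (hbdd x i)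
  have hHJB := hJ.satisfiesHJB_of_tendsto hchain hlim
  have hiff := hJ.isOptimalFeedback_iff_isGreedy hchain hlim
  obtain ⟨μ, hμ⟩ := hHJB.exists_isGreedy
  exact ⟨hlim, hJ.optimalValue_eq_of_tendsto hchain hlim, hHJB, ⟨μ, (hiff μ).2 hμ⟩,
    fun μ => ⟨hiff μ, fun hopt =>
      MJLS.satisfiesBellman_of_forall_eq hchain (hHJB.isGreedy_iff.1 ((hiff μ).1 hopt))⟩⟩

theorem theorem2 {n m q N : ℕ} (S : MJLS n m q N)
    {Ω : Type*} [MeasurableSpace Ω] (ℙ : Fin N → Measure Ω) (θ : ℕ → Ω → Fin N)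
    (hchain : IsModeChain S.trans ℙ θ)
    (hindep : S.ConditionallyIndependent ℙ θ)
    (hergodic : ModeErgodic ℙ θ)
    (hstab : S.MeanSquareStabilizable ℙ θ) :
    (∃ J u, S.IsValueIteration ℙ θ J u) ∧
    ∀ J u, S.IsValueIteration ℙ θ J u →
      (∀ x i, (∀ j, 0 ≤ J j x i) ∧ Monotone (fun j => J j x i) ∧
        BddAbove (Set.range fun j => J j x i)) ∧
      ∃ Jinf : (Fin n → ℝ) → Fin N → ℝ,
        (∀ x i, Filter.Tendsto (fun j => J j x i) Filter.atTop (nhds (Jinf x i))) ∧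
        (∀ x i, S.optimalValue ℙ θ x i = ENNReal.ofReal (Jinf x i)) ∧
        S.SatisfiesHJB ℙ θ Jinf ∧
        (∃ μ, S.IsOptimalFeedback ℙ θ μ) ∧
        ∀ μ, (S.IsOptimalFeedback ℙ θ μ ↔ S.IsGreedy ℙ θ Jinf μ) ∧
          (S.IsOptimalFeedback ℙ θ μ → S.SatisfiesBellman ℙ θ Jinf μ) :=
  theorem2_general S ℙ θ hchain (MJLS.optimalValue_lt_top hchain hstab)
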